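/- Let $n\ge 1$ and let $\mathbb{K}_2^n=\{x\in\mathbb{R}^n:\ \|\tilde x\|_2\le x_n\}$, where $\tilde x=(x_1,\dots,x_{n-1})$, be the second-order cone. Let $c_1,c_2\in\mathbb{R}^n$ and $c_{1,0},c_{2,0}\in\{0,1,-1\}$ with $c_{1,0}\ge c_{2,0}$, and put $C_i=\{x\in\mathbb{K}_2^n:\ c_i^\top x\ge c_{i,0}\}$ for $i=1,2$. Assume that $C_1\not\subseteq C_2$, $C_2\not\subseteq C_1$, and that $C_1$ and $C_2$ both meet the interior of $\mathbb{K}_2^n$. Let $\overline{\mathrm{conv}}(C_1\cup C_2)$ denote the closed convex hull of $C_1\cup C_2$. A linear inequality $\mu^\top x\ge\mu_0$ is valid for a set $S$ if it holds for all $x\in S$, and it is tight on $S$ if $\inf\{\mu^\top x:\ x\in S\}=\mu_0$. A linear inequality $\mu^\top x\ge\mu_0$ that is valid for $S\subseteq\mathbb{K}_2^n$ is undominated if there is no linear inequality $\nu^\top x\ge\nu_0$ valid for $S$ with $(\mu-\nu,\mu_0-\nu_0)\ne(0,0)$, $\mu-\nu\in(\mathbb{K}_2^n)^*$ and $\mu_0-\nu_0\le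 0$, where $(\mathbb{K}_2^n)^*=\{y\in\mathbb{R}^n:\ y^\top x\ge 0\ \text{for all}\ x\in\mathbb{K}_2^n\}$ is the dual cone. Suppose that $c_1-c_2\notin\pm\mathbb{K}_2^n$, and let $\mathcal{N}=\|\tilde c_1-\tilde c_2\|_2^2-(c_{1,n}-c_{2,n})^2$. Then the inequality $$2c_{2,0}-(c_1+c_2)^\top x\ \le\ \sqrt{\big((c_1-c_2)^\top x\big)^2+\mathcal{N}\,\big(x_n^2-\|\tilde x\|_2^2\big)}\qquad(*)$$ holds for every $x\in\overline{\mathrm{conv}}(C_1\cup C_2)$. Furthermore, $$\overline{\mathrm{conv}}(C_1\cup C_2)=\{x\in\mathbb{K}_2^n:\ x\text{ satisfies }(*)\}$$ whenever, in addition, at least one of the following holds: (i) $c_1\in\mathbb{K}_2^n$ or $c_2\in\mathbb{K}_2^n$; (ii) $c_{1,0}=c_{2,0}\in\{1,-1\}$, and the undominated valid linear inequalities for $\overline{\mathrm{conv}}(C_1\cup C_2)$ that are tight on both $C_1$ and $C_2$ suffice, together with the constraint $x\in\mathbb{K}_2^n$, to describe $\overline{\mathrm{conv}}(C_1\cup C_2)$;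 that is, $\overline{\mathrm{conv}}(C_1\cup C_2)$ is the set of all $x\in\mathbb{K}_2^n$ that satisfy every such inequality. -/

import Mathlib

namespace SOCDisj

/-- Euclidean space of dimension `m + 1`; the last coordinate `x (Fin.last m)` plays the role
of `x_n` (with `n = m + 1`). -/
abbrev Vec (m : ℕ) : Type := EuclideanSpace ℝ (Fin (m + 1))

/-- The vector of all coordinates of `x` but the last one. -/
def tilde {m : ℕ} (x : Vec m) : EuclideanSpace ℝ (Fin m) :=
  WithLp.toLp 2 (fun i : Fin m => x i.castSucc)

/-- The second-order cone in dimension `m + 1`. -/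
def soCone (m : ℕ) : Set (Vec m) := {x | ‖tilde x‖ ≤ x (Fin.last m)}

/-- One term of the disjunction: the points `x` of `K` with `cᵀ x ≥ c₀`. -/
def term {m : ℕ} (K : Set (Vec m)) (c : Vec m) (c₀ : ℝ) : Set (Vec m) :=
  {x | x ∈ K ∧ c₀ ≤ inner ℝ c x}

/-- The closed convex hull of the union of the two terms of the disjunction. -/
def hull {m : ℕ} (K : Set (Vec m)) (c₁ c₂ : Vec m) (c₁₀ c₂₀ : ℝ) : Set (Vec m) :=
  closedConvexHull ℝ (term K c₁ c₁₀ ∪ term K c₂ c₂₀)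

/-- The disjunctive setup on the cone `K`: right-hand sides in `{0, 1, -1}`, the first one not
smaller than the second one, neither term contained in the other, both strictly feasible. -/
structure DisjunctiveSetup {m : ℕ} (K : Set (Vec m)) (c₁ c₂ : Vec m) (c₁₀ c₂₀ : ℝ) : Prop where
  rhs₁ : c₁₀ ∈ ({0, 1, -1} : Set ℝ)
  rhs₂ : c₂₀ ∈ ({0, 1, -1} : Set ℝ)
  rhs_le : c₂₀ ≤ c₁₀
  not_subset : ¬ term K c₁ c₁₀ ⊆ term K c₂ c₂₀
  not_superset : ¬ term K c₂ c₂₀ ⊆ term K c₁ c₁₀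
  strictly_feasible₁ : (term K c₁ c₁₀ ∩ interior K).Nonempty
  strictly_feasible₂ : (term K c₂ c₂₀ ∩ interior K).Nonempty

/-- The linear inequality `μᵀ x ≥ μ₀` is valid for `S`. -/
def ValidLinear {m : ℕ} (S : Set (Vec m)) (μ : Vec m) (μ₀ : ℝ) : Prop :=
  ∀ x ∈ S, μ₀ ≤ inner ℝ μ x

/-- The linear inequality `μᵀ x ≥ μ₀` is tight on `S`: the infimum of `μᵀ x` over `S` is `μ₀`. -/
def Tight {m : ℕ} (S : Set (Vec m)) (μ : Vec m) (μ₀ : ℝ) : Prop :=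
  IsGLB ((fun x => inner ℝ μ x) '' S) μ₀

/-- `μᵀ x ≥ μ₀` is an undominated valid linear inequality for `S ⊆ K`: it is valid, and no valid
`νᵀ x ≥ ν₀` has `(μ - ν, μ₀ - ν₀)` a nonzero element of `K* × (-ℝ₊)`. -/
def UndominatedValid {m : ℕ} (K S : Set (Vec m)) (μ : Vec m) (μ₀ : ℝ) : Prop :=
  ValidLinear S μ μ₀ ∧
    ¬ ∃ (ν : Vec m) (ν₀ : ℝ), ValidLinear S ν ν₀ ∧
      μ - ν ∈ ProperCone.innerDual K ∧ μ₀ - ν₀ ≤ 0 ∧ (μ - ν, μ₀ - ν₀) ≠ (0, 0)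

/-- The undominated valid linear inequalities that are tight on both terms of the disjunction
describe the closed convex hull, together with the cone constraint. -/
def TightOnBothSuffice {m : ℕ} (K : Set (Vec m)) (c₁ c₂ : Vec m) (c₁₀ c₂₀ : ℝ) : Prop :=
  hull K c₁ c₂ c₁₀ c₂₀ =
    {x | x ∈ K ∧ ∀ (μ : Vec m) (μ₀ : ℝ),
      UndominatedValid K (hull K c₁ c₂ c₁₀ c₂₀) μ μ₀ →
      Tight (term K c₁ c₁₀) μ μ₀ → Tight (term K c₂ c₂₀) μ μ₀ →
      μ₀ ≤ inner ℝ μ x}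

/-- The number `‖c̃₁ - c̃₂‖² - (c₁ₙ - c₂ₙ)²`. -/
noncomputable def coeffN {m : ℕ} (c₁ c₂ : Vec m) : ℝ :=
  ‖tilde c₁ - tilde c₂‖ ^ 2 - (c₁ (Fin.last m) - c₂ (Fin.last m)) ^ 2

/-- The inequality
`2 c₂₀ - (c₁ + c₂)ᵀ x ≤ √(((c₁ - c₂)ᵀ x)² + N (xₙ² - ‖x̃‖²))` at the point `x`. -/
def SingleIneq {m : ℕ} (c₁ c₂ : Vec m) (c₂₀ : ℝ) (x : Vec m) : Prop :=
  2 * c₂₀ - inner ℝ (c₁ + c₂) x ≤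
    Real.sqrt ((inner ℝ (c₁ - c₂) x) ^ 2
      + coeffN c₁ c₂ * ((x (Fin.last m)) ^ 2 - ‖tilde x‖ ^ 2))

end SOCDisj

/-!
Write `q(x) = xₙ² - ‖x̃‖²` for the Lorentz form, so that `N = -q(c₁ - c₂)`, which is positive because
`c₁ - c₂ ∉ ±K`.

*Validity.* On either term the inequality holds because the left-hand side is at most
`|(c₁ - c₂)ᵀ x|`. It passes to the closed convex hull because the form under the root is,
up to the factor `‖c̃₁ - c̃₂‖²`, equal to `p(x)² - ‖v(x)‖²` for linear maps `p`, `v` with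
`‖v(x)‖ ≤ p(x)` on `K` (`under_root_eq`, `norm_transverse_le`), so that its root is concave on `K`
(`sqrt_sub_mul_sqrt_sub_le`) and the inequality cuts out a closed convex subset of `K`.

*Sufficiency.* By Hahn–Banach the hull is the intersection of the half-spaces `μᵀ x ≥ μ₀` that
contain both terms. By Lagrange duality under Slater's condition (`exists_multiplier`) such an
inequality can be written `μ = β₁ c₁ + α₁ = β₂ c₂ + α₂` with `αᵢ ∈ K`, `βᵢ ≥ 0` and
`μ₀ ≤ βᵢ cᵢ₀`. The link with the nonlinear inequality is
`-q(α₁ - α₂) q(x) ≤ 4 (α₁ᵀ x) (α₂ᵀ x)` for `α₁, α₂, x ∈ K` (`neg_lorentz_sub_mul_le`), which holds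
because reflecting a vector of the cone in a vector of the cone gives a vector of the cone.
If `β₁ = β₂ = 1` then `α₂ - α₁ = c₁ - c₂`, and the linear inequality follows from the nonlinear one
(`le_inner_of_singleIneq`). In case (ii), tightness forces `βᵢ cᵢ₀ = μ₀`, hence `β₁ = β₂`, and
scaling reduces to that situation. In case (i), say `c₁ ∈ K`, then `μ ∈ K`, and only
`μ₀ > 0` is of interest; this forces `c₁₀ = c₂₀ = 1`, and one may scale to `μ₀ = 1`. Now `βᵢ ≥ 1`,
and since `c₁ ∈ K` one can lower `β₁` to `1`; then either `c₂ ∈ K` and `β₂` can be lowered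
as well, or `q(c₂) ≤ 0` and the multiplier `β₂ ≥ 1` only helps (`one_le_inner_of_singleIneq`).
-/

namespace SOCDisj

open Filter Topology

variable {m : ℕ}

/-! ### Coordinates and the Lorentz form -/

@[simp] lemma tilde_add (x y : Vec m) : tilde (x + y) = tilde x + tilde y := by
  ext i; simp [tilde]

@[simp] lemma tilde_sub (x y : Vec m) : tilde (x - y) = tilde x - tilde y := by
  ext i; simp [tilde]

@[simp] lemma tilde_neg (x : Vec m) : tilde (-x) = -tilde x := by
  ext i; simp [tilde]

@[simp] lemma tilde_smul (t : ℝ) (x : Vec m) : tilde (t • x) = t • tilde x := by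
  ext i; simp [tilde]

@[simp] lemma tilde_zero : tilde (0 : Vec m) = 0 := by
  ext i; simp [tilde]

lemma continuous_tilde : Continuous (tilde : Vec m → EuclideanSpace ℝ (Fin m)) := by
  unfold tilde; fun_prop

lemma continuous_last : Continuous fun x : Vec m => x (Fin.last m) := by
  fun_prop

lemma inner_eq (x y : Vec m) :
    inner ℝ x y = inner ℝ (tilde x) (tilde y) + x (Fin.last m) * y (Fin.last m) := by
  simp [PiLp.inner_apply, tilde, Fin.sum_univ_castSucc, mul_comm]

/-- The vector with the given first coordinates and the given last coordinate. -/
def ofParts (u : EuclideanSpace ℝ (Fin m)) (t : ℝ) : Vec m :=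
  WithLp.toLp 2 (Fin.snoc (α := fun _ => ℝ) (fun i => u i) t)

@[simp] lemma tilde_ofParts (u : EuclideanSpace ℝ (Fin m)) (t : ℝ) : tilde (ofParts u t) = u := by
  ext i; simp [tilde, ofParts]

@[simp] lemma ofParts_last (u : EuclideanSpace ℝ (Fin m)) (t : ℝ) :
    ofParts u t (Fin.last m) = t := by
  simp [ofParts]

/-- The Lorentz form `xₙ² - ‖x̃‖²`. -/
noncomputable def lorentz (x : Vec m) : ℝ := x (Fin.last m) ^ 2 - ‖tilde x‖ ^ 2

lemma coeffN_eq (c₁ c₂ : Vec m) : coeffN c₁ c₂ = -lorentz (c₁ - c₂) := by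
  simp [coeffN, lorentz]

lemma lorentz_sub (x y : Vec m) :
    lorentz (x - y) = lorentz x + lorentz y
      - 2 * (x (Fin.last m) * y (Fin.last m) - inner ℝ (tilde x) (tilde y)) := by
  simp only [lorentz, tilde_sub, PiLp.sub_apply, norm_sub_sq_real]
  ring

lemma lorentz_smul (t : ℝ) (x : Vec m) : lorentz (t • x) = t ^ 2 * lorentz x := by
  simp only [lorentz, tilde_smul, PiLp.smul_apply, norm_smul, smul_eq_mul, mul_pow,
    Real.norm_eq_abs, sq_abs]
  ring

lemma lorentz_neg (x : Vec m) : lorentz (-x) = lorentz x := by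
  simp [lorentz]

/-! ### The second-order cone -/

lemma mem_soCone {x : Vec m} : x ∈ soCone m ↔ ‖tilde x‖ ≤ x (Fin.last m) := Iff.rfl

lemma zero_mem_soCone : (0 : Vec m) ∈ soCone m := by simp [mem_soCone]

lemma add_mem_soCone {x y : Vec m} (hx : x ∈ soCone m) (hy : y ∈ soCone m) :
    x + y ∈ soCone m := by
  rw [mem_soCone] at *
  simpa using (norm_add_le _ _).trans (add_le_add hx hy)

lemma smul_mem_soCone {t : ℝ} {x : Vec m} (ht : 0 ≤ t) (hx : x ∈ soCone m) :
    t • x ∈ soCone m := by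
  rw [mem_soCone] at *
  simpa [norm_smul, abs_of_nonneg ht] using mul_le_mul_of_nonneg_left hx ht

lemma convex_soCone : Convex ℝ (soCone m) := fun _ hx _ hy _ _ ha hb _ =>
  add_mem_soCone (smul_mem_soCone ha hx) (smul_mem_soCone hb hy)

lemma isClosed_soCone : IsClosed (soCone m) :=
  isClosed_le continuous_tilde.norm continuous_last

lemma lorentz_nonneg {x : Vec m} (hx : x ∈ soCone m) : 0 ≤ lorentz x :=
  sub_nonneg.2 (pow_le_pow_left₀ (norm_nonneg _) hx 2)

lemma inner_nonneg {x y : Vec m} (hx : x ∈ soCone m) (hy : y ∈ soCone m) :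
    0 ≤ inner ℝ x y := by
  rw [inner_eq]
  have h1 := abs_le.1 (abs_real_inner_le_norm (tilde x) (tilde y))
  have h2 := mul_le_mul hx hy (norm_nonneg _) ((norm_nonneg _).trans hx)
  linarith

/-- A linear functional bounded below on the cone is nonnegative there: the cone is self-dual. -/
lemma mem_soCone_of_le_inner {μ : Vec m} {k : ℝ} (h : ∀ x ∈ soCone m, k ≤ inner ℝ μ x) :
    μ ∈ soCone m ∧ k ≤ 0 := by
  have hk : k ≤ 0 := by simpa using h 0 zero_mem_soCone
  have h0 : ∀ x ∈ soCone m, 0 ≤ inner ℝ μ x := by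
    intro x hx
    by_contra! hlt
    have ht : 0 ≤ (k - 1) / inner ℝ μ x := div_nonneg_of_nonpos (by linarith) hlt.le
    have := h _ (smul_mem_soCone ht hx)
    rw [inner_smul_right, div_mul_cancel₀ _ hlt.ne] at this
    linarith
  refine ⟨?_, hk⟩
  rw [mem_soCone]
  rcases (norm_nonneg (tilde μ)).eq_or_lt with hz | hz
  · have := h0 (ofParts 0 1) (by simp [mem_soCone])
    simpa [inner_eq, ← hz] using this
  · have := h0 (ofParts (-tilde μ) ‖tilde μ‖) (by simp [mem_soCone])
    simp only [inner_eq, tilde_ofParts, ofParts_last, inner_neg_right,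
      real_inner_self_eq_norm_sq] at this
    nlinarith

lemma mem_or_neg_mem_of_lorentz_nonneg {x : Vec m} (hx : 0 ≤ lorentz x) :
    x ∈ soCone m ∨ -x ∈ soCone m := by
  have h := sq_le_sq.1 (sub_nonneg.1 hx)
  rw [abs_norm] at h
  simpa [mem_soCone] using le_abs.1 h

/-- Let `a' = (-ã, aₙ)`. The vector
`2 (aᵀ x) x - q(x) a'`, which for `q(x) > 0` is `q(x)` times the image of `a'` under the Lorentz
reflection in the axis `x`, lies in the cone. Pairing it with `b` gives the inequality. -/
lemma lorentz_mul_le {a b x : Vec m} (ha : a ∈ soCone m) (hb : b ∈ soCone m)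
    (hx : x ∈ soCone m) :
    (a (Fin.last m) * b (Fin.last m) - inner ℝ (tilde a) (tilde b)) * lorentz x
      ≤ 2 * inner ℝ a x * inner ℝ b x := by
  have hz : ofParts ((2 * inner ℝ a x) • tilde x + lorentz x • tilde a)
      (2 * inner ℝ a x * x (Fin.last m) - lorentz x * a (Fin.last m)) ∈ soCone m := by
    rw [mem_soCone, tilde_ofParts, ofParts_last]
    have hlast : 0 ≤ 2 * inner ℝ a x * x (Fin.last m) - lorentz x * a (Fin.last m) := by
      have h1 := (abs_le.1 (abs_real_inner_le_norm (tilde a) (tilde x))).1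
      have h2 := mul_le_mul_of_nonneg_right (mem_soCone.1 ha) (norm_nonneg (tilde x))
      have hx0 := (norm_nonneg _).trans hx
      have h3 : 0 ≤ x (Fin.last m)
          * (inner ℝ (tilde a) (tilde x) + a (Fin.last m) * ‖tilde x‖) :=
        mul_nonneg hx0 (by linarith)
      have h4 : 0 ≤ a (Fin.last m) * (x (Fin.last m) - ‖tilde x‖) ^ 2 :=
        mul_nonneg ((norm_nonneg _).trans ha) (sq_nonneg _)
      rw [inner_eq, lorentz]
      nlinarith
    refine abs_le_of_sq_le_sq' ?_ hlast |>.2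
    have hq := mul_nonneg (sq_nonneg (lorentz x)) (lorentz_nonneg ha)
    rw [norm_add_sq_real, norm_smul, norm_smul, inner_smul_left, inner_smul_right,
      mul_pow, mul_pow, Real.norm_eq_abs, Real.norm_eq_abs, sq_abs, sq_abs,
      real_inner_comm (tilde a)]
    have hA := inner_eq a x
    simp only [conj_trivial]
    have hX : ‖tilde x‖ ^ 2 = x (Fin.last m) ^ 2 - lorentz x := by rw [lorentz]; ring
    have hA2 : ‖tilde a‖ ^ 2 = a (Fin.last m) ^ 2 - lorentz a := by rw [lorentz]; ring
    have hI : inner ℝ (tilde a) (tilde x) = inner ℝ a x - a (Fin.last m) * x (Fin.last m) := by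
      rw [hA]; ring
    rw [hX, hA2, hI]
    nlinarith
  have h := inner_nonneg hz hb
  simp only [inner_eq (ofParts _ _), tilde_ofParts, ofParts_last, inner_add_left,
    inner_smul_left, conj_trivial] at h
  rw [inner_eq b x, real_inner_comm (tilde x)]
  linarith

lemma neg_lorentz_sub_mul_le {a b x : Vec m} (ha : a ∈ soCone m) (hb : b ∈ soCone m)
    (hx : x ∈ soCone m) :
    -lorentz (a - b) * lorentz x ≤ 4 * inner ℝ a x * inner ℝ b x := by
  have h := lorentz_mul_le ha hb hx
  have h1 := mul_nonneg (lorentz_nonneg ha) (lorentz_nonneg hx)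
  have h2 := mul_nonneg (lorentz_nonneg hb) (lorentz_nonneg hx)
  rw [lorentz_sub]
  linarith

/-! ### Lagrange duality for one constraint on the cone -/

lemma exists_strictly_feasible {c : Vec m} {c₀ : ℝ} (hc : c ≠ 0)
    (hf : (term (soCone m) c c₀ ∩ interior (soCone m)).Nonempty) :
    ∃ x ∈ soCone m, c₀ < inner ℝ c x := by
  obtain ⟨x, ⟨-, hx⟩, hxi⟩ := hf
  have hcont : Tendsto (fun t : ℝ => x + t • c) (𝓝[>] 0) (𝓝 x) := by
    have : Continuous fun t : ℝ => x + t • c := by fun_prop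
    simpa using (this.tendsto 0).mono_left nhdsWithin_le_nhds
  obtain ⟨t, htK, ht⟩ :=
    ((hcont.eventually_mem (mem_interior_iff_mem_nhds.1 hxi)).and self_mem_nhdsWithin).exists
  refine ⟨_, htK, ?_⟩
  rw [inner_add_right, inner_smul_right]
  have := mul_pos (Set.mem_Ioi.1 ht) (real_inner_self_pos.2 hc)
  linarith

/-- Lagrange duality with attainment: a linear inequality valid on the part of the cone cut out by
one strictly feasible linear constraint is the sum of a multiple of the constraint and an inequality
valid on the cone. -/
lemma exists_multiplier {c μ : Vec m} {c₀ μ₀ : ℝ}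
    (hf : (term (soCone m) c c₀ ∩ interior (soCone m)).Nonempty)
    (hv : ValidLinear (term (soCone m) c c₀) μ μ₀) :
    ∃ β : ℝ, 0 ≤ β ∧ μ - β • c ∈ soCone m ∧ μ₀ ≤ β * c₀ := by
  by_cases hc : c = 0
  · obtain ⟨x, ⟨-, hx⟩, -⟩ := hf
    have h := mem_soCone_of_le_inner (μ := μ) (k := μ₀) fun y hy => hv y ⟨hy, by
      rw [hc, inner_zero_left] at hx ⊢; exact hx⟩
    exact ⟨0, le_rfl, by simpa using h.1, by simpa using h.2⟩
  obtain ⟨x₀, hx₀, hcx₀⟩ := exists_strictly_feasible hc hf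
  -- the pairs (objective excess, constraint slack) attained on the cone, up to strict inequality
  let A : Set (ℝ × ℝ) :=
    {p | ∃ x ∈ soCone m, inner ℝ μ x - μ₀ < p.1 ∧ p.2 < inner ℝ c x - c₀}
  have hAconv : Convex ℝ A := by
    rintro p ⟨x, hx, hx1, hx2⟩ r ⟨y, hy, hy1, hy2⟩ s t hs ht hst
    refine ⟨_, convex_soCone hx hy hs ht hst, ?_, ?_⟩
    · have := (convex_Ioi (0 : ℝ)) (Set.mem_Ioi.2 (sub_pos.2 hx1)) (Set.mem_Ioi.2 (sub_pos.2 hy1))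
        hs ht hst
      simp only [smul_eq_mul, Set.mem_Ioi] at this
      simp only [inner_add_right, inner_smul_right, Prod.fst_add, Prod.smul_fst, smul_eq_mul]
      linear_combination this + μ₀ * hst
    · have := (convex_Ioi (0 : ℝ)) (Set.mem_Ioi.2 (sub_pos.2 hx2)) (Set.mem_Ioi.2 (sub_pos.2 hy2))
        hs ht hst
      simp only [smul_eq_mul, Set.mem_Ioi] at this
      simp only [inner_add_right, inner_smul_right, Prod.snd_add, Prod.smul_snd, smul_eq_mul]
      linear_combination this - c₀ * hst
  have hAopen : IsOpen A := by
    have : A = ⋃ x ∈ soCone m,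
        Set.Ioi (inner ℝ μ x - μ₀) ×ˢ Set.Iio (inner ℝ c x - c₀) := by
      ext p; simp [A, and_left_comm]
    rw [this]
    exact isOpen_biUnion fun x _ => isOpen_Ioi.prod isOpen_Iio
  have hA0 : (0 : ℝ × ℝ) ∉ A := by
    rintro ⟨x, hx, h1, h2⟩
    have h1' : inner ℝ μ x - μ₀ < 0 := h1
    have h2' : 0 < inner ℝ c x - c₀ := h2
    linarith [hv x ⟨hx, by linarith⟩]
  obtain ⟨f, hfA⟩ := geometric_hahn_banach_point_open hAconv hAopen hA0
  set p := f (1, 0)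
  set r := f (0, 1)
  have hfeq : ∀ s t : ℝ, f (s, t) = s * p + t * r := by
    intro s t
    have : ((s, t) : ℝ × ℝ) = s • (1, 0) + t • (0, 1) := by simp
    rw [this, map_add, map_smul, map_smul, smul_eq_mul, smul_eq_mul]
  have hpos : ∀ x ∈ soCone m, ∀ s > 0, ∀ t > 0,
      0 < (inner ℝ μ x - μ₀ + s) * p + (inner ℝ c x - c₀ - t) * r := by
    intro x hx s hs t ht
    have := hfA (inner ℝ μ x - μ₀ + s, inner ℝ c x - c₀ - t)
      ⟨x, hx, by simpa using hs, by simpa using ht⟩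
    rwa [map_zero, hfeq] at this
  have hp0 : 0 ≤ p := by
    by_contra! hp
    set k := (inner ℝ μ x₀ - μ₀) * p + (inner ℝ c x₀ - c₀ - 1) * r with hk
    have := hpos x₀ hx₀ (|k| / -p + 1) (by have := div_nonneg (abs_nonneg k) (neg_nonneg.2 hp.le)
                                           linarith) 1 one_pos
    have h2 : |k| / -p * p = -|k| := by rw [div_neg, neg_mul, div_mul_cancel₀ _ hp.ne]
    have h3 := le_abs_self k
    nlinarith
  have hr0 : r ≤ 0 := by
    by_contra! hr
    set k := (inner ℝ μ x₀ - μ₀ + 1) * p + (inner ℝ c x₀ - c₀) * r with hk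
    have := hpos x₀ hx₀ 1 one_pos (|k| / r + 1) (by have := div_nonneg (abs_nonneg k) hr.le
                                                    linarith)
    have h2 : |k| / r * r = |k| := by field_simp
    have h3 := le_abs_self k
    nlinarith
  -- Slater's condition excludes a vertical separating line
  have hp : 0 < p := by
    refine hp0.lt_of_ne fun hp => ?_
    have := hpos x₀ hx₀ 1 one_pos ((inner ℝ c x₀ - c₀) / 2) (by linarith)
    rw [← hp] at this
    nlinarith
  have hle : ∀ x ∈ soCone m, 0 ≤ (inner ℝ μ x - μ₀) * p + (inner ℝ c x - c₀) * r := by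
    intro x hx
    refine le_of_forall_pos_le_add fun δ hδ => ?_
    have hs : 0 < δ / (p - r) := div_pos hδ (by linarith)
    have h := hpos x hx _ hs _ hs
    have h2 : δ / (p - r) * (p - r) = δ := div_mul_cancel₀ _ (by linarith)
    nlinarith
  have hcone := mem_soCone_of_le_inner (μ := μ - (-r / p) • c) (k := μ₀ - (-r / p) * c₀) (by
    intro x hx
    rw [inner_sub_left, inner_smul_left, conj_trivial]
    have h := div_nonneg (hle x hx) hp.le
    have h2 : ((inner ℝ μ x - μ₀) * p + (inner ℝ c x - c₀) * r) / p
        = (inner ℝ μ x - μ₀) + (inner ℝ c x - c₀) * (r / p) := by field_simp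
    rw [h2] at h
    rw [neg_div]
    linarith)
  exact ⟨-r / p, div_nonneg (by linarith) hp.le, hcone.1, by linarith [hcone.2]⟩

/-- If the inequality is moreover tight, the multiplier reproduces its right-hand side. -/
lemma exists_multiplier_of_tight {c μ : Vec m} {c₀ μ₀ : ℝ}
    (hf : (term (soCone m) c c₀ ∩ interior (soCone m)).Nonempty)
    (ht : Tight (term (soCone m) c c₀) μ μ₀) :
    ∃ β : ℝ, 0 ≤ β ∧ μ - β • c ∈ soCone m ∧ μ₀ = β * c₀ := by
  obtain ⟨β, hβ, hmem, hle⟩ :=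
    exists_multiplier hf fun x hx => ht.1 (Set.mem_image_of_mem _ hx)
  refine ⟨β, hβ, hmem, hle.antisymm (ht.2 ?_)⟩
  rintro _ ⟨x, hx, rfl⟩
  have h := inner_nonneg hmem hx.1
  rw [inner_sub_left, inner_smul_left, conj_trivial] at h
  have := mul_le_mul_of_nonneg_left hx.2 hβ
  simp only
  linarith

/-! ### Linear consequences of the nonlinear inequality -/

lemma singleIneq_comm {c₁ c₂ : Vec m} {k : ℝ} {x : Vec m} (h : SingleIneq c₁ c₂ k x) :
    SingleIneq c₂ c₁ k x := by
  unfold SingleIneq at *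
  have h1 : inner ℝ (c₂ - c₁) x = -inner ℝ (c₁ - c₂) x := by
    rw [← inner_neg_left, neg_sub]
  have h2 : coeffN c₂ c₁ = coeffN c₁ c₂ := by
    rw [coeffN_eq, coeffN_eq, ← neg_sub, lorentz_neg]
  rwa [h1, h2, neg_sq, add_comm c₂ c₁]

lemma le_inner_of_singleIneq {c₁ c₂ μ x : Vec m} {k : ℝ} (hx : x ∈ soCone m)
    (hs : SingleIneq c₁ c₂ k x) (h₁ : μ - c₁ ∈ soCone m) (h₂ : μ - c₂ ∈ soCone m) :
    k ≤ inner ℝ μ x := by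
  have hkey := neg_lorentz_sub_mul_le h₂ h₁ hx
  have hd : μ - c₂ - (μ - c₁) = c₁ - c₂ := by abel
  rw [hd, ← coeffN_eq] at hkey
  have ha := inner_nonneg h₁ hx
  have hb := inner_nonneg h₂ hx
  unfold SingleIneq at hs
  change _ ≤ Real.sqrt (_ + coeffN c₁ c₂ * lorentz x) at hs
  have hroot : Real.sqrt (inner ℝ (c₁ - c₂) x ^ 2 + coeffN c₁ c₂ * lorentz x)
      ≤ inner ℝ (μ - c₁) x + inner ℝ (μ - c₂) x := by
    refine Real.sqrt_le_iff.2 ⟨by linarith, ?_⟩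
    have : inner ℝ (c₁ - c₂) x = inner ℝ (μ - c₂) x - inner ℝ (μ - c₁) x := by
      rw [← inner_sub_left, hd]
    rw [this]
    linarith
  have := hs.trans hroot
  simp only [inner_sub_left, inner_add_left] at this
  linarith

/-- With unequal multipliers `1` and `β ≥ 1`, the signs of `q(c₁)` and `q(c₂)` give
`β N ≤ -q(β c₂ - c₁)`, so the product estimate is strong enough. -/
lemma one_le_inner_of_singleIneq {c₁ c₂ μ x : Vec m} {β : ℝ} (hx : x ∈ soCone m)
    (hs : SingleIneq c₁ c₂ 1 x) (hc₁ : c₁ ∈ soCone m) (hc₂ : lorentz c₂ ≤ 0) (hβ : 1 ≤ β)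
    (h₁ : μ - c₁ ∈ soCone m) (h₂ : μ - β • c₂ ∈ soCone m) :
    1 ≤ inner ℝ μ x := by
  by_contra! hlt
  have hkey := neg_lorentz_sub_mul_le h₁ h₂ hx
  have hd : μ - c₁ - (μ - β • c₂) = β • c₂ - c₁ := by abel
  have hN : β * coeffN c₁ c₂ ≤ -lorentz (β • c₂ - c₁) := by
    rw [coeffN_eq, lorentz_sub, lorentz_sub, lorentz_smul, tilde_smul, inner_smul_left,
      PiLp.smul_apply, smul_eq_mul, conj_trivial, real_inner_comm (tilde c₁)]
    have h1 := mul_nonneg (sub_nonneg.2 hβ) (lorentz_nonneg hc₁)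
    have h2 : 0 ≤ β * (β - 1) * -lorentz c₂ :=
      mul_nonneg (mul_nonneg (by linarith) (by linarith)) (by linarith)
    linarith
  rw [hd] at hkey
  have ha := inner_nonneg h₁ hx
  have hb := inner_nonneg h₂ hx
  simp only [inner_sub_left, inner_smul_left, conj_trivial] at ha hb hkey
  set s := inner ℝ c₁ x
  set t := inner ℝ c₂ x
  set u := inner ℝ μ x
  have hβ0 : 0 < β := by linarith
  have ht : t < 1 := by
    by_contra! h
    nlinarith
  unfold SingleIneq at hs
  change _ ≤ Real.sqrt (_ + coeffN c₁ c₂ * lorentz x) at hs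
  rw [inner_add_left, inner_sub_left, Real.le_sqrt' (by linarith)] at hs
  have h1 : β * (4 * (1 - s) * (1 - t)) ≤ β * (coeffN c₁ c₂ * lorentz x) :=
    mul_le_mul_of_nonneg_left (by linarith) hβ0.le
  have h2 := mul_le_mul_of_nonneg_right hN (lorentz_nonneg hx)
  have h3 : (u - s) * (u - β * t) < (1 - s) * (β * (1 - t)) :=
    mul_lt_mul'' (by linarith) (by linarith) ha hb
  linarith

/-- A valid inequality with multipliers `β₁`, `β₂` follows from the nonlinear one as soon as
`c₁` lies in the cone and the right-hand sides are `1`. -/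
lemma le_inner_of_mem_soCone {c₁ c₂ μ x : Vec m} {β₁ β₂ μ₀ : ℝ} (hx : x ∈ soCone m)
    (hs : SingleIneq c₁ c₂ 1 x) (hc₁ : c₁ ∈ soCone m) (hne : (term (soCone m) c₂ 1).Nonempty)
    (hβ₁ : 0 ≤ β₁) (h₁ : μ - β₁ • c₁ ∈ soCone m) (h₂ : μ - β₂ • c₂ ∈ soCone m)
    (hle₁ : μ₀ ≤ β₁) (hle₂ : μ₀ ≤ β₂) : μ₀ ≤ inner ℝ μ x := by
  rcases le_or_gt μ₀ 0 with h0 | h0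
  · have : μ ∈ soCone m := by simpa using add_mem_soCone h₁ (smul_mem_soCone hβ₁ hc₁)
    exact h0.trans (inner_nonneg this hx)
  have hscale : ∀ {β : ℝ} {c : Vec m}, μ - β • c ∈ soCone m →
      μ₀⁻¹ • μ - (β / μ₀) • c ∈ soCone m := by
    intro β c h
    have := smul_mem_soCone (inv_nonneg.2 h0.le) h
    rwa [smul_sub, smul_smul, ← div_eq_inv_mul] at this
  -- a multiplier larger than `1` of a vector of the cone can be lowered to `1`
  have hlower : ∀ {β : ℝ} {c : Vec m}, c ∈ soCone m → μ₀ ≤ β → μ - β • c ∈ soCone m →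
      μ₀⁻¹ • μ - c ∈ soCone m := by
    intro β c hc hβ h
    have h1 : 0 ≤ β / μ₀ - 1 := sub_nonneg.2 ((one_le_div h0).2 hβ)
    have := add_mem_soCone (hscale h) (smul_mem_soCone h1 hc)
    rwa [sub_smul, one_smul, sub_add_sub_cancel] at this
  have key : 1 ≤ inner ℝ (μ₀⁻¹ • μ) x := by
    by_cases hc₂ : c₂ ∈ soCone m
    · exact le_inner_of_singleIneq hx hs (hlower hc₁ hle₁ h₁) (hlower hc₂ hle₂ h₂)
    · refine one_le_inner_of_singleIneq hx hs hc₁ ?_ ((one_le_div h0).2 hle₂)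
        (hlower hc₁ hle₁ h₁) (hscale h₂)
      by_contra! hq
      obtain ⟨y, hy, hy1⟩ := hne
      have := inner_nonneg ((mem_or_neg_mem_of_lorentz_nonneg hq.le).resolve_left hc₂) hy
      rw [inner_neg_left] at this
      linarith
  rw [inner_smul_left, conj_trivial, ← div_eq_inv_mul, one_le_div h0] at key
  exact key

/-! ### Concavity of the root -/

/-- Reverse Cauchy–Schwarz inequality in two dimensions. -/
lemma sqrt_sub_mul_sqrt_sub_le {p v p' v' : ℝ} (hv : 0 ≤ v) (hv' : 0 ≤ v') (h : v ≤ p)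
    (h' : v' ≤ p') :
    Real.sqrt (p ^ 2 - v ^ 2) * Real.sqrt (p' ^ 2 - v' ^ 2) ≤ p * p' - v * v' := by
  have h0 : 0 ≤ p ^ 2 - v ^ 2 := sub_nonneg.2 (pow_le_pow_left₀ hv h 2)
  rw [← Real.sqrt_mul h0]
  refine Real.sqrt_le_iff.2 ⟨sub_nonneg.2 (mul_le_mul h h' hv' (hv.trans h)), ?_⟩
  linarith [sq_nonneg (p * v' - p' * v)]

/-- The component of `x̃` orthogonal to `d̃`, times `‖d̃‖ √N`, where `N = -q(d)`. -/
noncomputable def transverse (d x : Vec m) : EuclideanSpace ℝ (Fin m) :=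
  Real.sqrt (-lorentz d) •
    (‖tilde d‖ • tilde x - (inner ℝ (tilde d) (tilde x) / ‖tilde d‖) • tilde d)

/-- A linear form that, after scaling by `‖d̃‖`, dominates the transverse component on the cone. -/
noncomputable def axial (d x : Vec m) : ℝ :=
  ‖tilde d‖ ^ 2 * x (Fin.last m) + d (Fin.last m) * inner ℝ (tilde d) (tilde x)

lemma transverse_add (d x y : Vec m) :
    transverse d (x + y) = transverse d x + transverse d y := by
  simp only [transverse, tilde_add, inner_add_right, ← smul_add, add_div, add_smul]
  congr 1
  rw [smul_add]
  abel

lemma axial_add (d x y : Vec m) : axial d (x + y) = axial d x + axial d y := by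
  simp only [axial, tilde_add, inner_add_right, PiLp.add_apply]
  ring

lemma norm_transverse_sq {d : Vec m} (hd : lorentz d ≤ 0) (hd0 : tilde d ≠ 0) (x : Vec m) :
    ‖transverse d x‖ ^ 2 = -lorentz d *
      (‖tilde d‖ ^ 2 * ‖tilde x‖ ^ 2 - inner ℝ (tilde d) (tilde x) ^ 2) := by
  have h0 : ‖tilde d‖ ≠ 0 := norm_ne_zero_iff.2 hd0
  rw [transverse, norm_smul, mul_pow, Real.norm_eq_abs, sq_abs, Real.sq_sqrt (by linarith),
    norm_sub_sq_real, norm_smul, norm_smul, inner_smul_left, inner_smul_right, mul_pow, mul_pow,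
    Real.norm_eq_abs, Real.norm_eq_abs, sq_abs, sq_abs, real_inner_comm (tilde d), conj_trivial]
  field_simp
  ring

/-- On the hyperplane orthogonal to `d` the form under the root is `N q`, and it does not change
along the Lorentz-orthogonal direction `(-d̃, dₙ)`. -/
lemma under_root_eq {d : Vec m} (hd : lorentz d ≤ 0) (hd0 : tilde d ≠ 0) (x : Vec m) :
    ‖tilde d‖ ^ 2 * (inner ℝ d x ^ 2 + -lorentz d * lorentz x)
      = axial d x ^ 2 - ‖transverse d x‖ ^ 2 := by
  rw [norm_transverse_sq hd hd0, inner_eq, axial, lorentz, lorentz]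
  ring

lemma norm_transverse_le {d x : Vec m} (hd : lorentz d ≤ 0) (hd0 : tilde d ≠ 0)
    (hx : x ∈ soCone m) : ‖transverse d x‖ ≤ axial d x := by
  have hpos : 0 ≤ axial d x := by
    have h1 := abs_real_inner_le_norm (tilde d) (tilde x)
    have h2 : |d (Fin.last m)| ≤ ‖tilde d‖ := abs_le_of_sq_le_sq (sub_nonpos.1 hd) (norm_nonneg _)
    have h3 : |d (Fin.last m) * inner ℝ (tilde d) (tilde x)|
        ≤ ‖tilde d‖ * (‖tilde d‖ * x (Fin.last m)) := by
      rw [abs_mul]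
      exact mul_le_mul h2 (h1.trans (mul_le_mul_of_nonneg_left hx (norm_nonneg _)))
        (abs_nonneg _) (norm_nonneg _)
    rw [axial]
    linarith [(abs_le.1 h3).1]
  refine abs_le_of_sq_le_sq' ?_ hpos |>.2
  have h := under_root_eq hd hd0 x
  have h2 : 0 ≤ ‖tilde d‖ ^ 2 * (inner ℝ d x ^ 2 + -lorentz d * lorentz x) :=
    mul_nonneg (sq_nonneg _) (add_nonneg (sq_nonneg _)
      (mul_nonneg (by linarith) (lorentz_nonneg hx)))
  linarith

/-- The root is superadditive on the cone. -/
lemma sqrt_add_sqrt_le {d x y : Vec m} (hd : lorentz d ≤ 0) (hd0 : tilde d ≠ 0)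
    (hx : x ∈ soCone m) (hy : y ∈ soCone m) :
    Real.sqrt (inner ℝ d x ^ 2 + -lorentz d * lorentz x)
        + Real.sqrt (inner ℝ d y ^ 2 + -lorentz d * lorentz y)
      ≤ Real.sqrt (inner ℝ d (x + y) ^ 2 + -lorentz d * lorentz (x + y)) := by
  have h0 : 0 < ‖tilde d‖ := norm_pos_iff.2 hd0
  have hscale : ∀ z, ‖tilde d‖ * Real.sqrt (inner ℝ d z ^ 2 + -lorentz d * lorentz z)
      = Real.sqrt (axial d z ^ 2 - ‖transverse d z‖ ^ 2) := by
    intro z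
    rw [← under_root_eq hd hd0, Real.sqrt_mul (sq_nonneg _), Real.sqrt_sq h0.le]
  refine le_of_mul_le_mul_left ?_ h0
  rw [mul_add, hscale, hscale, hscale, axial_add, transverse_add]
  have hvx := norm_transverse_le hd hd0 hx
  have hvy := norm_transverse_le hd hd0 hy
  refine Real.le_sqrt_of_sq_le ?_
  have h1 := sqrt_sub_mul_sqrt_sub_le (norm_nonneg _) (norm_nonneg _) hvx hvy
  have h2 := real_inner_le_norm (transverse d x) (transverse d y)
  have hqx := Real.sq_sqrt (sub_nonneg.2 (pow_le_pow_left₀ (norm_nonneg _) hvx 2))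
  have hqy := Real.sq_sqrt (sub_nonneg.2 (pow_le_pow_left₀ (norm_nonneg _) hvy 2))
  rw [add_sq, hqx, hqy, norm_add_sq_real]
  linarith

lemma sqrt_smul {d x : Vec m} {t : ℝ} (ht : 0 ≤ t) :
    Real.sqrt (inner ℝ d (t • x) ^ 2 + -lorentz d * lorentz (t • x))
      = t * Real.sqrt (inner ℝ d x ^ 2 + -lorentz d * lorentz x) := by
  have : inner ℝ d (t • x) ^ 2 + -lorentz d * lorentz (t • x)
      = t ^ 2 * (inner ℝ d x ^ 2 + -lorentz d * lorentz x) := by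
    rw [inner_smul_right, lorentz_smul]
    ring
  rw [this, Real.sqrt_mul (sq_nonneg _), Real.sqrt_sq ht]

lemma singleIneq_iff {c₁ c₂ x : Vec m} {k : ℝ} : SingleIneq c₁ c₂ k x ↔
    2 * k - inner ℝ (c₁ + c₂) x ≤
      Real.sqrt (inner ℝ (c₁ - c₂) x ^ 2 + -lorentz (c₁ - c₂) * lorentz x) := by
  rw [SingleIneq, coeffN_eq, lorentz.eq_1 x]

lemma convex_singleIneq {c₁ c₂ : Vec m} (hd : lorentz (c₁ - c₂) ≤ 0)
    (hd0 : tilde (c₁ - c₂) ≠ 0) (k : ℝ) :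
    Convex ℝ {x | x ∈ soCone m ∧ SingleIneq c₁ c₂ k x} := by
  rintro x ⟨hx, hsx⟩ y ⟨hy, hsy⟩ s t hs ht hst
  refine ⟨convex_soCone hx hy hs ht hst, ?_⟩
  rw [singleIneq_iff] at *
  have h := sqrt_add_sqrt_le hd hd0 (smul_mem_soCone hs hx) (smul_mem_soCone ht hy)
  rw [sqrt_smul hs, sqrt_smul ht] at h
  refine le_trans ?_ h
  have h1 := mul_le_mul_of_nonneg_left hsx hs
  have h2 := mul_le_mul_of_nonneg_left hsy ht
  rw [inner_add_right, inner_smul_right, inner_smul_right]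
  linear_combination h1 + h2 - 2 * k * hst

lemma isClosed_singleIneq (c₁ c₂ : Vec m) (k : ℝ) :
    IsClosed {x | x ∈ soCone m ∧ SingleIneq c₁ c₂ k x} := by
  have h := continuous_tilde (m := m)
  have h1 : Continuous fun x : Vec m => 2 * k - inner ℝ (c₁ + c₂) x := by fun_prop
  have h2 : Continuous fun x : Vec m => Real.sqrt (inner ℝ (c₁ - c₂) x ^ 2
      + coeffN c₁ c₂ * (x (Fin.last m) ^ 2 - ‖tilde x‖ ^ 2)) := by fun_prop
  exact isClosed_soCone.inter (isClosed_le h1 h2)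

/-! ### The closed convex hull of the disjunction -/

lemma lorentz_neg_of_notMem {d : Vec m} (hpos : d ∉ soCone m) (hneg : -d ∉ soCone m) :
    lorentz d < 0 := by
  by_contra! h
  exact (mem_or_neg_mem_of_lorentz_nonneg h).elim hpos hneg

lemma tilde_ne_zero_of_lorentz_neg {d : Vec m} (hd : lorentz d < 0) : tilde d ≠ 0 := by
  intro h
  rw [lorentz, h, norm_zero] at hd
  nlinarith [sq_nonneg (d (Fin.last m))]

lemma singleIneq_of_mem_term {c₁ c₂ x : Vec m} {k : ℝ} (hd : lorentz (c₁ - c₂) ≤ 0)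
    (hx : x ∈ term (soCone m) c₁ k) : SingleIneq c₁ c₂ k x := by
  rw [singleIneq_iff]
  have h1 := mul_nonneg (neg_nonneg.2 hd) (lorentz_nonneg hx.1)
  refine le_trans ?_ (Real.abs_le_sqrt (x := inner ℝ (c₁ - c₂) x) (by linarith))
  refine le_trans ?_ (le_abs_self _)
  have := hx.2
  rw [inner_add_left, inner_sub_left]
  linarith

lemma hull_subset {c₁ c₂ : Vec m} {c₁₀ c₂₀ : ℝ} (hle : c₂₀ ≤ c₁₀)
    (hd : lorentz (c₁ - c₂) < 0) :
    hull (soCone m) c₁ c₂ c₁₀ c₂₀ ⊆ {x | x ∈ soCone m ∧ SingleIneq c₁ c₂ c₂₀ x} := by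
  refine closedConvexHull_min ?_ (convex_singleIneq hd.le (tilde_ne_zero_of_lorentz_neg hd) _)
    (isClosed_singleIneq _ _ _)
  rintro x (hx | hx)
  · exact ⟨hx.1, singleIneq_of_mem_term hd.le ⟨hx.1, hle.trans hx.2⟩⟩
  · refine ⟨hx.1, singleIneq_comm (singleIneq_of_mem_term ?_ hx)⟩
    rw [← neg_sub, lorentz_neg]
    exact hd.le

/-- The hull is the intersection of the half-spaces that contain both terms. -/
lemma mem_hull_of_forall {K : Set (Vec m)} {c₁ c₂ x : Vec m} {c₁₀ c₂₀ : ℝ}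
    (h : ∀ μ μ₀, ValidLinear (term K c₁ c₁₀) μ μ₀ → ValidLinear (term K c₂ c₂₀) μ μ₀ →
      μ₀ ≤ inner ℝ μ x) : x ∈ hull K c₁ c₂ c₁₀ c₂₀ := by
  by_contra hx
  obtain ⟨f, u, hfx, hf⟩ := geometric_hahn_banach_point_closed
    (convex_closedConvexHull (𝕜 := ℝ)) isClosed_closedConvexHull hx
  set μ := (InnerProductSpace.toDual ℝ (Vec m)).symm f
  have hμ : ∀ y, inner ℝ μ y = f y := fun y => InnerProductSpace.toDual_symm_apply
  have hsub : ∀ y ∈ term K c₁ c₁₀ ∪ term K c₂ c₂₀, u ≤ inner ℝ μ y := fun y hy => by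
    rw [hμ]; exact (hf y (subset_closedConvexHull hy)).le
  have := h μ u (fun y hy => hsub y (.inl hy)) (fun y hy => hsub y (.inr hy))
  rw [hμ] at this
  linarith

lemma term_eq_of_mem_soCone {c : Vec m} {k : ℝ} (hc : c ∈ soCone m) (hk : k ≤ 0) :
    term (soCone m) c k = soCone m :=
  Set.Subset.antisymm (fun _ hx => hx.1) fun _ hx => ⟨hx, hk.trans (inner_nonneg hc hx)⟩

lemma mem_hull_of_mem_soCone {c₁ c₂ x : Vec m} {c₁₀ c₂₀ : ℝ}
    (hsetup : DisjunctiveSetup (soCone m) c₁ c₂ c₁₀ c₂₀)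
    (hc : c₁ ∈ soCone m ∨ c₂ ∈ soCone m) (hx : x ∈ soCone m)
    (hs : SingleIneq c₁ c₂ c₂₀ x) : x ∈ hull (soCone m) c₁ c₂ c₁₀ c₂₀ := by
  refine mem_hull_of_forall fun μ μ₀ hv₁ hv₂ => ?_
  obtain ⟨β₁, hβ₁, hm₁, hle₁⟩ := exists_multiplier hsetup.strictly_feasible₁ hv₁
  obtain ⟨β₂, hβ₂, hm₂, hle₂⟩ := exists_multiplier hsetup.strictly_feasible₂ hv₂
  have hne₁ := hsetup.strictly_feasible₁.mono Set.inter_subset_left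
  have hne₂ := hsetup.strictly_feasible₂.mono Set.inter_subset_left
  have hrhs₁ : c₁₀ = 0 ∨ c₁₀ = 1 ∨ c₁₀ = -1 := by simpa using hsetup.rhs₁
  have hrhs₂ : c₂₀ = 0 ∨ c₂₀ = 1 ∨ c₂₀ = -1 := by simpa using hsetup.rhs₂
  have hle := hsetup.rhs_le
  rcases hc with hc | hc
  · have h1 : 0 < c₁₀ := by
      by_contra! h
      exact hsetup.not_superset
        ((term_eq_of_mem_soCone hc h).symm ▸ fun _ hy => hy.1)
    obtain rfl : c₁₀ = 1 := by rcases hrhs₁ with h | h | h <;> linarith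
    rcases le_or_gt c₂₀ 0 with h2 | h2
    · have hμ : μ ∈ soCone m := by simpa using add_mem_soCone hm₁ (smul_mem_soCone hβ₁ hc)
      have := mul_nonpos_of_nonneg_of_nonpos hβ₂ h2
      linarith [inner_nonneg hμ hx]
    · obtain rfl : c₂₀ = 1 := by rcases hrhs₂ with h | h | h <;> linarith
      exact le_inner_of_mem_soCone hx hs hc hne₂ hβ₁ hm₁ hm₂ (by linarith) (by linarith)
  · have h2 : 0 < c₂₀ := by
      by_contra! h
      exact hsetup.not_subset
        ((term_eq_of_mem_soCone hc h).symm ▸ fun _ hy => hy.1)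
    obtain rfl : c₂₀ = 1 := by rcases hrhs₂ with h | h | h <;> linarith
    obtain rfl : c₁₀ = 1 := by rcases hrhs₁ with h | h | h <;> linarith
    exact le_inner_of_mem_soCone hx (singleIneq_comm hs) hc hne₁ hβ₂ hm₂ hm₁
      (by linarith) (by linarith)

lemma mem_hull_of_tightOnBothSuffice {c₁ c₂ x : Vec m} {k : ℝ}
    (hsetup : DisjunctiveSetup (soCone m) c₁ c₂ k k) (hk : k ≠ 0)
    (hsuff : TightOnBothSuffice (soCone m) c₁ c₂ k k) (hx : x ∈ soCone m)
    (hs : SingleIneq c₁ c₂ k x) : x ∈ hull (soCone m) c₁ c₂ k k := by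
  rw [hsuff]
  refine ⟨hx, fun μ μ₀ _ ht₁ ht₂ => ?_⟩
  obtain ⟨β, hβ, hm₁, h₁⟩ := exists_multiplier_of_tight hsetup.strictly_feasible₁ ht₁
  obtain ⟨β', -, hm₂, h₂⟩ := exists_multiplier_of_tight hsetup.strictly_feasible₂ ht₂
  obtain rfl : β = β' := mul_right_cancel₀ hk (h₁.symm.trans h₂)
  rcases hβ.eq_or_lt with rfl | hβ
  · rw [h₁, zero_mul]
    exact inner_nonneg (by simpa using hm₁) hx
  have hscale : ∀ c, μ - β • c ∈ soCone m → β⁻¹ • μ - c ∈ soCone m := fun c hc => by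
    simpa [smul_sub, smul_smul, hβ.ne'] using smul_mem_soCone (inv_nonneg.2 hβ.le) hc
  have h := le_inner_of_singleIneq hx hs (hscale _ hm₁) (hscale _ hm₂)
  rw [inner_smul_left, conj_trivial, ← div_eq_inv_mul, le_div_iff₀ hβ] at h
  linarith

end SOCDisj

theorem mainTheorem2 (m : ℕ) (c₁ c₂ : SOCDisj.Vec m) (c₁₀ c₂₀ : ℝ)
    (hsetup : SOCDisj.DisjunctiveSetup (SOCDisj.soCone m) c₁ c₂ c₁₀ c₂₀)
    (hpos : c₁ - c₂ ∉ SOCDisj.soCone m)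
    (hneg : -(c₁ - c₂) ∉ SOCDisj.soCone m) :
    (∀ x ∈ SOCDisj.hull (SOCDisj.soCone m) c₁ c₂ c₁₀ c₂₀, SOCDisj.SingleIneq c₁ c₂ c₂₀ x) ∧
    (((c₁ ∈ SOCDisj.soCone m ∨ c₂ ∈ SOCDisj.soCone m) ∨
        (c₁₀ = c₂₀ ∧ (c₁₀ = 1 ∨ c₁₀ = -1) ∧
          SOCDisj.TightOnBothSuffice (SOCDisj.soCone m) c₁ c₂ c₁₀ c₂₀)) →
      SOCDisj.hull (SOCDisj.soCone m) c₁ c₂ c₁₀ c₂₀ =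
        {x | x ∈ SOCDisj.soCone m ∧ SOCDisj.SingleIneq c₁ c₂ c₂₀ x}) := by
  have hsub := SOCDisj.hull_subset hsetup.rhs_le (SOCDisj.lorentz_neg_of_notMem hpos hneg)
  refine ⟨fun x hx => (hsub hx).2, fun h => hsub.antisymm fun x ⟨hx, hs⟩ => ?_⟩
  rcases h with hc | ⟨rfl, hk, hsuff⟩
  · exact SOCDisj.mem_hull_of_mem_soCone hsetup hc hx hs
  · refine SOCDisj.mem_hull_of_tightOnBothSuffice hsetup ?_ hsuff hx hs
    rcases hk with rfl | rfl <;> norm_num
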